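/- Let $\lambda,c>0$ and $p,q\ge 0$ with $p+q\le 1$. A particle $(X(t),Y(t))$ starts at the origin of the plane at time $0$ and moves with constant speed $c$ along one of the four directions $d_j=(\cos(\pi j/2),\sin(\pi j/2))$, $j=0,1,2,3$ (indices modulo $4$). The initial direction is uniform on $\{d_0,d_1,d_2,d_3\}$. The direction changes at the events of a homogeneous Poisson process of rate $\lambda$ (whose interarrival times are i.i.d. exponential with rate $\lambda$): at each event, independently of everything else, the current direction $d_j$ is replaced by $d_{j+1}$ with probability $p$, by $d_{j-1}$ with probability $q$, and by $d_{j+2}$ with probability $1-p-q$. Then for all $t>0$ and $\alpha\in\mathbb{R}$ with $\lambda^2(1-p-q)^2\neq\alpha^2c^2$, $$\mathbb{E}\left[e^{i\alpha X(t)}\,\mathbf 1_{\{Y(t)=0\}}\right]=\frac{e^{-\lambda t}}{4}\left[\left(1+\frac{\lambda(1-p-q)}{s}\right)e^{ts}+\left(1-\frac{\lambda(1-p-q)}{s}\right)e^{-ts}\right],\qquad s=\sqrt{\lambda^2(1-p-q)^2-\alpha^2c^2},$$ where $s$ is either of the two complex square roots. If $\lambda^2(1-p-q)^2=\alpha^2c^2$,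 the formula holds with the right-hand side replaced by its limit as $s\to 0$: $$\mathbb{E}\left[e^{i\alpha X(t)}\,\mathbf 1_{\{Y(t)=0\}}\right]=\frac{e^{-\lambda t}}{2}\left[1+\lambda(1-p-q)\,t\right].$$ -/

import Mathlib

open MeasureTheory ProbabilityTheory

/-- The four orthogonal directions `d_j = (cos (π j / 2), sin (π j / 2))`, indexed modulo `4`. -/
noncomputable def orthDir (j : Fin 4) : ℝ × ℝ :=
  (Real.cos (Real.pi / 2 * (j : ℕ)), Real.sin (Real.pi / 2 * (j : ℕ)))

/-- The randomness that drives the planar motion with Poisson rate `lam`, probability `p` of a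
counter-clockwise turn, probability `q` of a clockwise turn and probability `1 - p - q` of a
reflection: the index `D₀` of the initial direction, the times `τ 0, τ 1, …` between consecutive
events of the Poisson process, and the turns `ξ 0, ξ 1, …` taken at these events, where a turn is
the increment modulo `4` of the index of the direction. -/
structure IsMotionDriver {Ω : Type*} [MeasurableSpace Ω] (P : Measure Ω) (lam p q : ℝ)
    (D₀ : Ω → Fin 4) (τ : ℕ → Ω → ℝ) (ξ : ℕ → Ω → Fin 4) : Prop where
  measurable_init : Measurable D₀
  measurable_wait : ∀ k, Measurable (τ k)
  measurable_turn : ∀ k, Measurable (ξ k)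
  /-- The initial direction is uniform. -/
  init_law : ∀ j, P.real {ω | D₀ ω = j} = 1 / 4
  /-- The interarrival times are exponential with rate `lam`. -/
  wait_law : ∀ k, P.map (τ k) = expMeasure lam
  turn_counterclockwise : ∀ k, P.real {ω | ξ k ω = 1} = p
  turn_clockwise : ∀ k, P.real {ω | ξ k ω = -1} = q
  turn_reflection : ∀ k, P.real {ω | ξ k ω = 2} = 1 - p - q
  /-- The initial direction, all interarrival times and all turns are mutually independent. -/
  indep_wait : iIndepFun τ P
  indep_turn : iIndepFun ξ P
  indep_wait_turn : IndepFun (fun ω k => τ k ω) (fun ω k => ξ k ω) P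
  indep_init : IndepFun D₀ (fun ω => ((fun k => τ k ω), (fun k => ξ k ω))) P

/-- The Poisson process `N(t)`: the number of arrival times `τ 0 + ⋯ + τ n`, `n = 0, 1, …`, that
are at most `t`. -/
noncomputable def numEvents {Ω : Type*} (τ : ℕ → Ω → ℝ) (t : ℝ) (ω : Ω) : ℕ :=
  {n : ℕ | ∑ i ∈ Finset.range (n + 1), τ i ω ≤ t}.ncard

/-- The index of the direction `D(t)` at time `t`. -/
noncomputable def dirIndex {Ω : Type*} (D₀ : Ω → Fin 4) (τ : ℕ → Ω → ℝ) (ξ : ℕ → Ω → Fin 4)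
    (t : ℝ) (ω : Ω) : Fin 4 :=
  D₀ ω + ∑ k ∈ Finset.range (numEvents τ t ω), ξ k ω

/-- The abscissa `X(t)` of the particle that starts at the origin and moves with speed `c`. -/
noncomputable def motionX {Ω : Type*} (c : ℝ) (D₀ : Ω → Fin 4) (τ : ℕ → Ω → ℝ)
    (ξ : ℕ → Ω → Fin 4) (t : ℝ) (ω : Ω) : ℝ :=
  ∫ s in (0 : ℝ)..t, c * (orthDir (dirIndex D₀ τ ξ s ω)).1

/-- The ordinate `Y(t)` of the particle that starts at the origin and moves with speed `c`. -/
noncomputable def motionY {Ω : Type*} (c : ℝ) (D₀ : Ω → Fin 4) (τ : ℕ → Ω → ℝ)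
    (ξ : ℕ → Ω → Fin 4) (t : ℝ) (ω : Ω) : ℝ :=
  ∫ s in (0 : ℝ)..t, c * (orthDir (dirIndex D₀ τ ξ s ω)).2

/-! Almost surely `Y(t) = 0` only if the particle has never left the horizontal axis. Otherwise
`Y(t) = 0` is a nontrivial affine relation between finitely many waiting times, which are
independent and without atoms, so it has probability zero (`measure_linearCombination_eq_zero`).
Hence the particle starts along `d_0` or `d_2` and every turn up to time `t` is a reflection, so
`X(t)` is `± c` times an alternating sum of waiting times.

Write `ρ = λ(1-p-q)`. Conditioning on the successive waiting times (`integral_countedPhase`) and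
using independence, the paths with exactly `n` reflections contribute `e^{-λt}/4 · ρ^n V_n(b, t)`
for each of the starts `b = αc` and `b = -αc`, where `V_n` is the iterated integral
`alternatingVolterra`. The series `∑ ρ^n V_n(b, t)` is the Neumann series of the system `κ_b' = I b
κ_b + ρ κ_{-b}`, `κ_b(0) = 1`, whose solution is `cosh(ts) + (ρ + I b) sinh(ts)/s` with `s² = ρ² -
b²`. Adding the two starts cancels the term in `I b`. -/

/-! ### Neumann series of the two-component linear system -/

/-- The iterates of the Volterra operator `f ↦ ∫₀ᵗ exp (I b (t - v)) f v dv`, with the sign of the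
frequency `b` alternating, applied to `exp (I b t)`. -/
noncomputable def alternatingVolterra : ℕ → ℝ → ℝ → ℂ
  | 0, b, t => Complex.exp (Complex.I * b * t)
  | n + 1, b, t => Complex.exp (Complex.I * b * t) *
      ∫ v in (0 : ℝ)..t, Complex.exp (-(Complex.I * b * v)) * alternatingVolterra n (-b) v

theorem continuous_alternatingVolterra (n : ℕ) (b : ℝ) : Continuous (alternatingVolterra n b) := by
  induction n generalizing b with
  | zero =>
    change Continuous fun t : ℝ => Complex.exp (Complex.I * b * t)
    fun_prop
  | succ n ih =>
    change Continuous fun t : ℝ => Complex.exp (Complex.I * b * t) *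
      ∫ v in (0 : ℝ)..t, Complex.exp (-(Complex.I * b * v)) * alternatingVolterra n (-b) v
    refine Continuous.mul (by fun_prop) ?_
    refine intervalIntegral.continuous_primitive (fun a b => Continuous.intervalIntegrable ?_ a b) 0
    have := ih (-b)
    fun_prop

/-- Substitution `x = t - v`. This is the form that arises from conditioning on the first waiting
time `x`. -/
theorem alternatingVolterra_succ_eq_convolution (n : ℕ) (b t : ℝ) :
    alternatingVolterra (n + 1) b t =
      ∫ x in (0 : ℝ)..t, Complex.exp (Complex.I * b * x) * alternatingVolterra n (-b) (t - x) := by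
  have h := intervalIntegral.integral_comp_sub_left (a := 0) (b := t)
    (fun v : ℝ => Complex.exp (Complex.I * b * (t - v : ℝ)) * alternatingVolterra n (-b) v) t
  simp only [sub_sub_cancel, sub_self, sub_zero] at h
  rw [h, alternatingVolterra, ← intervalIntegral.integral_const_mul]
  congr 1; ext v
  rw [← mul_assoc, ← Complex.exp_add]
  congr 2; push_cast; ring

/-- The remainder of the Neumann series of the system `κ_b' = I b κ_b + ρ κ_{-b}`. -/
theorem neumann_remainder_succ {ρ β : ℝ} {κ : ℝ → ℝ → ℂ}
    (hκ : ∀ b, b ^ 2 = β ^ 2 → ∀ t,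
      HasDerivAt (κ b) (Complex.I * b * κ b t + ρ * κ (-b) t) t)
    (hκ0 : ∀ b, b ^ 2 = β ^ 2 → κ b 0 = 1) (N : ℕ) {b : ℝ} (hb : b ^ 2 = β ^ 2) (t : ℝ) :
    κ b t - ∑ n ∈ Finset.range (N + 1), (ρ : ℂ) ^ n * alternatingVolterra n b t =
      Complex.exp (Complex.I * b * t) * ∫ v in (0 : ℝ)..t,
        ρ * (Complex.exp (-(Complex.I * b * v)) *
          (κ (-b) v - ∑ n ∈ Finset.range N, (ρ : ℂ) ^ n * alternatingVolterra n (-b) v)) := by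
  have hb' : (-b) ^ 2 = β ^ 2 := by rw [neg_sq, hb]
  have hcont : ∀ b, b ^ 2 = β ^ 2 → Continuous (κ b) := fun b hb =>
    continuous_iff_continuousAt.2 fun t => (hκ b hb t).continuousAt
  have hc' := hcont _ hb'
  have hA := fun n => continuous_alternatingVolterra n (-b)
  -- Variation of constants: the integrating factor `exp (-I b v)` removes the diagonal term of the
  -- system.
  have hftc : ∫ v in (0 : ℝ)..t, ρ * (Complex.exp (-(Complex.I * b * v)) * κ (-b) v) =
      Complex.exp (-(Complex.I * b * t)) * κ b t - 1 := by
    have hd : ∀ v ∈ Set.uIcc 0 t, HasDerivAt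
        (fun v : ℝ => Complex.exp (-(Complex.I * b * v)) * κ b v)
        (ρ * (Complex.exp (-(Complex.I * b * v)) * κ (-b) v)) v := by
      intro v _
      have h1 : HasDerivAt (fun v : ℝ => -(Complex.I * b * (v : ℂ))) (-(Complex.I * b * 1)) v :=
        ((Complex.ofRealCLM.hasDerivAt (x := v)).const_mul _).neg
      refine (h1.cexp.mul (hκ b hb v)).congr_deriv ?_
      ring
    rw [intervalIntegral.integral_eq_sub_of_hasDerivAt hd
      (Continuous.intervalIntegrable (by fun_prop) _ _)]
    simp [hκ0 b hb]
  have hsplit : ∀ v : ℝ, ρ * (Complex.exp (-(Complex.I * b * v)) *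
          (κ (-b) v - ∑ n ∈ Finset.range N, (ρ : ℂ) ^ n * alternatingVolterra n (-b) v)) =
      ρ * (Complex.exp (-(Complex.I * b * v)) * κ (-b) v) -
        ∑ n ∈ Finset.range N, (ρ : ℂ) ^ (n + 1) *
          (Complex.exp (-(Complex.I * b * v)) * alternatingVolterra n (-b) v) := by
    intro v
    rw [mul_sub, mul_sub, Finset.mul_sum, Finset.mul_sum]
    congr 1
    refine Finset.sum_congr rfl fun n _ => ?_
    ring
  simp_rw [hsplit]
  rw [intervalIntegral.integral_sub (Continuous.intervalIntegrable (by fun_prop) _ _)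
    (Continuous.intervalIntegrable (by fun_prop) _ _), hftc,
    intervalIntegral.integral_finsetSum
      (fun n _ => Continuous.intervalIntegrable (by fun_prop) _ _)]
  simp_rw [intervalIntegral.integral_const_mul]
  rw [Finset.sum_range_succ', mul_sub, mul_sub, ← mul_assoc, ← Complex.exp_add, add_neg_cancel,
    Finset.mul_sum]
  have : ∀ n ∈ Finset.range N, (ρ : ℂ) ^ (n + 1) * alternatingVolterra (n + 1) b t =
      Complex.exp (Complex.I * b * t) * ((ρ : ℂ) ^ (n + 1) * ∫ v in (0 : ℝ)..t,
        Complex.exp (-(Complex.I * b * v)) * alternatingVolterra n (-b) v) := by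
    intro n _
    rw [alternatingVolterra]; ring
  rw [Finset.sum_congr rfl this]
  simp [alternatingVolterra]
  ring

theorem norm_exp_I_mul_mul (b t : ℝ) : ‖Complex.exp (Complex.I * b * t)‖ = 1 := by
  rw [show Complex.I * b * t = ((b * t : ℝ) : ℂ) * Complex.I by push_cast; ring,
    Complex.norm_exp_ofReal_mul_I]

/-- The Neumann series of the system `κ_b' = I b κ_b + ρ κ_{-b}`, `κ_b 0 = 1`. -/
theorem tendsto_sum_alternatingVolterra {ρ β : ℝ} {κ : ℝ → ℝ → ℂ}
    (hκ : ∀ b, b ^ 2 = β ^ 2 → ∀ t,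
      HasDerivAt (κ b) (Complex.I * b * κ b t + ρ * κ (-b) t) t)
    (hκ0 : ∀ b, b ^ 2 = β ^ 2 → κ b 0 = 1) {t : ℝ} (ht : 0 ≤ t) :
    Filter.Tendsto
      (fun N => ∑ n ∈ Finset.range N, (ρ : ℂ) ^ n * alternatingVolterra n β t)
      Filter.atTop (nhds (κ β t)) := by
  have hcont : ∀ b, b ^ 2 = β ^ 2 → Continuous (κ b) := fun b hb =>
    continuous_iff_continuousAt.2 fun t => (hκ b hb t).continuousAt
  obtain ⟨C₁, hC₁⟩ := (isCompact_Icc (a := 0) (b := t)).exists_bound_of_continuousOn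
    (hcont β rfl).continuousOn
  obtain ⟨C₂, hC₂⟩ := (isCompact_Icc (a := 0) (b := t)).exists_bound_of_continuousOn
    (hcont (-β) (neg_sq β)).continuousOn
  set C := max C₁ C₂
  -- Each iteration exchanges `b` and `-b`, so the induction treats both frequencies with one
  -- constant `C`; integrating `x ^ N` produces the factorial.
  have hbound : ∀ N : ℕ, ∀ b, b ^ 2 = β ^ 2 → ∀ v ∈ Set.Icc 0 t,
      ‖κ b v - ∑ n ∈ Finset.range N, (ρ : ℂ) ^ n * alternatingVolterra n b v‖ ≤
        C * ((|ρ| * v) ^ N / N.factorial) := by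
    intro N
    induction N with
    | zero =>
      intro b hb v hv
      rcases sq_eq_sq_iff_eq_or_eq_neg.1 hb with rfl | rfl
      · simpa only [Finset.range_zero, Finset.sum_empty, sub_zero, pow_zero, Nat.factorial_zero,
          Nat.cast_one, div_one, mul_one] using (hC₁ v hv).trans (le_max_left C₁ C₂)
      · simpa only [Finset.range_zero, Finset.sum_empty, sub_zero, pow_zero, Nat.factorial_zero,
          Nat.cast_one, div_one, mul_one] using (hC₂ v hv).trans (le_max_right C₁ C₂)
    | succ N ih =>
      intro b hb v hv
      rw [neumann_remainder_succ hκ hκ0 N hb v, norm_mul, norm_exp_I_mul_mul, one_mul]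
      have hle : ∀ x ∈ Set.Ioc 0 v, ‖ρ * (Complex.exp (-(Complex.I * b * x)) *
          (κ (-b) x - ∑ n ∈ Finset.range N, (ρ : ℂ) ^ n * alternatingVolterra n (-b) x))‖ ≤
          C * (|ρ| ^ (N + 1) / N.factorial) * x ^ N := by
        intro x hx
        have h1 := norm_exp_I_mul_mul (-b) x
        rw [Complex.ofReal_neg, mul_neg, neg_mul] at h1
        rw [norm_mul, norm_mul, h1, one_mul, Complex.norm_real, Real.norm_eq_abs]
        calc _ ≤ |ρ| * (C * ((|ρ| * x) ^ N / N.factorial)) := by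
              gcongr
              exact ih (-b) (by rw [neg_sq, hb]) x ⟨hx.1.le, hx.2.trans hv.2⟩
          _ = _ := by ring
      refine (intervalIntegral.norm_integral_le_of_norm_le hv.1
        (Filter.Eventually.of_forall hle)
        (Continuous.intervalIntegrable (by fun_prop) _ _)).trans (le_of_eq ?_)
      rw [intervalIntegral.integral_const_mul, integral_pow, Nat.factorial_succ]
      push_cast
      field_simp
      ring
  rw [tendsto_iff_norm_sub_tendsto_zero]
  refine squeeze_zero (fun _ => norm_nonneg _)
    (fun N => (norm_sub_rev _ _).le.trans (hbound N β rfl t ⟨ht, le_rfl⟩)) ?_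
  simpa using (FloorSemiring.tendsto_pow_div_factorial_atTop (|ρ| * t)).const_mul C

/-- The limit is `cosh (t s) + (ρ + I b) sinh (t s) / s` at `b = β`. The system holds because `I b
(ρ + I b) + ρ (ρ - I b) = ρ² - b² = s²`, with the same `s` for `b` and `-b`. -/
theorem tendsto_sum_alternatingVolterra_of_ne_zero {ρ β : ℝ} {s : ℂ}
    (hs : s ^ 2 = ((ρ ^ 2 - β ^ 2 : ℝ) : ℂ)) (hs0 : s ≠ 0) {t : ℝ} (ht : 0 ≤ t) :
    Filter.Tendsto
      (fun N => ∑ n ∈ Finset.range N, (ρ : ℂ) ^ n * alternatingVolterra n β t)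
      Filter.atTop (nhds (((1 + (ρ + Complex.I * β) / s) * Complex.exp (t * s) +
        (1 - (ρ + Complex.I * β) / s) * Complex.exp (-(t * s))) / 2)) := by
  refine tendsto_sum_alternatingVolterra (β := β)
    (κ := fun b t => ((1 + (ρ + Complex.I * b) / s) * Complex.exp (t * s) +
        (1 - (ρ + Complex.I * b) / s) * Complex.exp (-(t * s))) / 2) ?_ ?_ ht
  · intro b hb t
    have h1 : HasDerivAt (fun v : ℝ => (v : ℂ) * s) (1 * s) t :=
      (Complex.ofRealCLM.hasDerivAt (x := t)).mul_const _
    have h2 : HasDerivAt (fun v : ℝ => -((v : ℂ) * s)) (-(1 * s)) t := h1.neg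
    refine (((h1.cexp.const_mul _).add (h2.cexp.const_mul _)).div_const 2).congr_deriv ?_
    rw [← hb] at hs
    push_cast at hs ⊢
    field_simp
    linear_combination (Complex.exp (s * t) - Complex.exp (-(s * t))) * hs -
      (b : ℂ) ^ 2 * (Complex.exp (s * t) - Complex.exp (-(s * t))) * Complex.I_sq
  · intro b _
    simp

/-- The degenerate case `s = 0`, where `sinh (t s) / s` becomes `t`. -/
theorem tendsto_sum_alternatingVolterra_of_eq_zero {ρ β : ℝ} (h : ρ ^ 2 - β ^ 2 = 0)
    {t : ℝ} (ht : 0 ≤ t) :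
    Filter.Tendsto
      (fun N => ∑ n ∈ Finset.range N, (ρ : ℂ) ^ n * alternatingVolterra n β t)
      Filter.atTop (nhds (1 + (ρ + Complex.I * β) * t)) := by
  refine tendsto_sum_alternatingVolterra (β := β)
    (κ := fun b t => 1 + (ρ + Complex.I * b) * t) ?_ ?_ ht
  · intro b hb t
    have h1 : HasDerivAt (fun v : ℝ => (v : ℂ)) 1 t := Complex.ofRealCLM.hasDerivAt (x := t)
    refine ((h1.const_mul (ρ + Complex.I * b)).const_add 1).congr_deriv ?_
    rw [← hb] at h
    have h' : (ρ : ℂ) ^ 2 - (b : ℂ) ^ 2 = 0 := by exact_mod_cast h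
    push_cast
    linear_combination -(t : ℂ) * h' - t * (b : ℂ) ^ 2 * Complex.I_sq
  · intro b _
    simp

/-! ### Exponential waiting times and the mean phase -/

theorem integral_expMeasure_ite_le {lam t : ℝ} (hlam : 0 < lam) (ht : 0 ≤ t) (f : ℝ → ℂ) :
    ∫ x, (if x ≤ t then f x else 0) ∂(expMeasure lam) =
      ∫ x in (0 : ℝ)..t, ((lam * Real.exp (-(lam * x)) : ℝ) : ℂ) * f x := by
  have h : expMeasure lam = volume.withDensity (exponentialPDF lam) := rfl
  -- The density does not vanish at `0`, so the integrands agree pointwise on `Icc 0 t`, which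
  -- differs from `Ioc 0 t` by a null set.
  rw [h, integral_withDensity_eq_integral_toReal_smul
    (show Measurable (exponentialPDF lam) from
      (measurable_exponentialPDFReal lam).ennreal_ofReal)
    (Filter.Eventually.of_forall fun x => ENNReal.ofReal_lt_top),
    intervalIntegral.integral_of_le ht, ← integral_Icc_eq_integral_Ioc,
    ← integral_indicator measurableSet_Icc]
  congr 1; ext x
  rw [exponentialPDF_eq]
  by_cases h0 : 0 ≤ x
  · rw [if_pos h0, ENNReal.toReal_ofReal (by positivity), Complex.real_smul]
    by_cases h1 : x ≤ t <;> simp [Set.indicator, h0, h1]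
  · simp [Set.indicator, h0]

theorem expMeasure_real_Ioi {lam t : ℝ} (hlam : 0 < lam) (ht : 0 ≤ t) :
    (expMeasure lam).real (Set.Ioi t) = Real.exp (-(lam * t)) := by
  have := isProbabilityMeasure_expMeasure hlam
  rw [← Set.compl_Iic, probReal_compl_eq_one_sub measurableSet_Iic, ← cdf_eq_real,
    cdf_expMeasure_eq hlam, if_pos ht]
  ring

/-- On the event that exactly `n` of the partial sums of the waiting times `u` are at most `t`,
this is `exp (I b z)`, where `z` is the position at time `t` of the motion of unit speed which
reverses its direction after each waiting time; elsewhere it vanishes. -/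
noncomputable def countedPhase : (n : ℕ) → ℝ → ℝ → (Fin (n + 1) → ℝ) → ℂ
  | 0, b, t, u => if t < u 0 then Complex.exp (Complex.I * b * t) else 0
  | n + 1, b, t, u => if u 0 ≤ t then
      Complex.exp (Complex.I * b * u 0) * countedPhase n (-b) (t - u 0) (fun i => u i.succ) else 0

theorem measurable_countedPhase (n : ℕ) (b : ℝ) :
    Measurable fun x : ℝ × (Fin (n + 1) → ℝ) => countedPhase n b x.1 x.2 := by
  induction n generalizing b with
  | zero =>
    exact Measurable.ite (measurableSet_lt (by fun_prop) (by fun_prop)) (by fun_prop) (by fun_prop)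
  | succ n ih =>
    refine Measurable.ite (measurableSet_le (by fun_prop) (by fun_prop)) ?_ (by fun_prop)
    refine Measurable.mul (by fun_prop) ?_
    exact (ih (-b)).comp (f := fun x : ℝ × (Fin (n + 2) → ℝ) =>
      (x.1 - x.2 0, fun i : Fin (n + 1) => x.2 i.succ)) (by fun_prop)

theorem norm_countedPhase_le (n : ℕ) (b t : ℝ) (u : Fin (n + 1) → ℝ) :
    ‖countedPhase n b t u‖ ≤ 1 := by
  induction n generalizing b t with
  | zero =>
    rw [countedPhase]
    split_ifs
    · exact (norm_exp_I_mul_mul b t).le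
    · simp
  | succ n ih =>
    rw [countedPhase]
    split_ifs
    · rw [norm_mul, norm_exp_I_mul_mul, one_mul]
      exact ih _ _ _
    · simp

/-- Induction by conditioning on the first waiting time `x`: its density `lam e^{-lam x}` times the
factor `e^{-lam (t - x)}` of the remaining motion is `lam e^{-lam t}`, independent of `x`, which
leaves the convolution recursion. For `n = 0` the factor is the probability of no event before `t`.
-/
theorem integral_countedPhase {lam : ℝ} (hlam : 0 < lam) (n : ℕ) (b : ℝ) {t : ℝ} (ht : 0 ≤ t) :
    ∫ u, countedPhase n b t u ∂(Measure.pi fun _ : Fin (n + 1) => expMeasure lam) =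
      Complex.exp (-(lam * t)) * (lam : ℂ) ^ n * alternatingVolterra n b t := by
  have := isProbabilityMeasure_expMeasure hlam
  induction n generalizing b t with
  | zero =>
    have hmp := measurePreserving_eval (fun _ : Fin 1 => expMeasure lam) 0
    have h1 := integral_map (μ := Measure.pi fun _ : Fin 1 => expMeasure lam)
      (φ := Function.eval 0) hmp.measurable.aemeasurable
      (f := fun x : ℝ => if t < x then Complex.exp (Complex.I * b * t) else 0)
      (Measurable.ite measurableSet_Ioi (by fun_prop) (by fun_prop)).aestronglyMeasurable
    rw [hmp.map_eq] at h1
    simp only [countedPhase]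
    refine h1.symm.trans ?_
    have h2 : (fun x : ℝ => if t < x then Complex.exp (Complex.I * b * t) else 0) =
        (Set.Ioi t).indicator fun _ => Complex.exp (Complex.I * b * t) := by
      ext x; simp [Set.indicator]
    rw [h2, integral_indicator_const _ measurableSet_Ioi, expMeasure_real_Ioi hlam ht]
    simp [alternatingVolterra]
  | succ n ih =>
    have hmp := (measurePreserving_piFinSuccAbove (fun _ : Fin (n + 2) => expMeasure lam) 0).symm
    rw [← hmp.integral_comp' ]
    have hint : Integrable (fun x : ℝ × (Fin (n + 1) → ℝ) => if x.1 ≤ t then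
        Complex.exp (Complex.I * b * x.1) * countedPhase n (-b) (t - x.1) x.2 else 0)
        ((expMeasure lam).prod (Measure.pi fun _ : Fin (n + 1) => expMeasure lam)) := by
      refine Integrable.of_bound (C := 1) (Measurable.aestronglyMeasurable ?_)
        (Filter.Eventually.of_forall fun x => ?_)
      · refine Measurable.ite (measurableSet_le (by fun_prop) (by fun_prop)) ?_ (by fun_prop)
        exact Measurable.mul (by fun_prop) ((measurable_countedPhase n (-b)).comp
          (f := fun x : ℝ × (Fin (n + 1) → ℝ) => (t - x.1, x.2)) (by fun_prop))
      · split_ifs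
        · rw [norm_mul, norm_exp_I_mul_mul, one_mul]
          exact norm_countedPhase_le _ _ _ _
        · simp
    have hfun : (fun x => countedPhase (n + 1) b t
        ((MeasurableEquiv.piFinSuccAbove (fun _ : Fin (n + 2) => ℝ) 0).symm x)) =
        fun x : ℝ × (Fin (n + 1) → ℝ) => if x.1 ≤ t then
        Complex.exp (Complex.I * b * x.1) * countedPhase n (-b) (t - x.1) x.2 else 0 := by
      ext x
      simp [countedPhase, MeasurableEquiv.piFinSuccAbove]
    rw [hfun, integral_prod _ hint]
    have hinner : ∀ x : ℝ, ∫ y, (if x ≤ t then Complex.exp (Complex.I * b * x) *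
        countedPhase n (-b) (t - x) y else 0) ∂(Measure.pi fun _ : Fin (n + 1) => expMeasure lam) =
        if x ≤ t then Complex.exp (Complex.I * b * x) * (Complex.exp (-(lam * (t - x : ℝ))) *
          (lam : ℂ) ^ n * alternatingVolterra n (-b) (t - x)) else 0 := by
      intro x
      split_ifs with hx
      · rw [integral_const_mul, ih (-b) (sub_nonneg.2 hx)]
      · simp
    simp_rw [hinner]
    rw [integral_expMeasure_ite_le hlam ht, alternatingVolterra_succ_eq_convolution,
      ← intervalIntegral.integral_const_mul]
    congr 1; ext x
    have hexp : Complex.exp (-(lam * t)) =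
        Complex.exp (-(lam * x)) * Complex.exp (-(lam * (t - x : ℝ))) := by
      rw [← Complex.exp_add]; congr 1; push_cast; ring
    rw [hexp]
    push_cast
    ring

/-! ### Sample paths: event counts, integrals and phases -/

theorem strictMono_sum_range {u : ℕ → ℝ} (hu : ∀ k, 0 < u k) :
    StrictMono fun n => ∑ i ∈ Finset.range n, u i :=
  strictMono_nat_of_lt_succ fun n => by
    rw [Finset.sum_range_succ]
    exact lt_add_of_pos_right _ (hu n)

section Path

variable {Ω : Type*} {τ : ℕ → Ω → ℝ} {ω : Ω}

theorem numEvents_eq (hu : ∀ k, 0 < τ k ω) {n : ℕ} {s : ℝ}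
    (h1 : ∑ i ∈ Finset.range n, τ i ω ≤ s) (h2 : s < ∑ i ∈ Finset.range (n + 1), τ i ω) :
    numEvents τ s ω = n := by
  have hS := strictMono_sum_range hu
  have : {m : ℕ | ∑ i ∈ Finset.range (m + 1), τ i ω ≤ s} = Set.Iio n := by
    ext m
    refine ⟨fun hm => ?_, fun hm => ?_⟩
    · have : m + 1 < n + 1 := hS.lt_iff_lt.1 (lt_of_le_of_lt hm h2)
      exact Nat.lt_of_succ_lt_succ this
    · exact (hS.monotone (Nat.succ_le_of_lt hm)).trans h1
  rw [numEvents, this, ← Finset.coe_Iio, Set.ncard_coe_finset, Nat.card_Iio]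

theorem exists_sum_range_le_lt {u : ℕ → ℝ} {t : ℝ} (ht : 0 ≤ t)
    (h : ∃ n, t < ∑ i ∈ Finset.range n, u i) :
    ∃ n, ∑ i ∈ Finset.range n, u i ≤ t ∧ t < ∑ i ∈ Finset.range (n + 1), u i := by
  classical
  obtain ⟨m, hm⟩ : ∃ m, Nat.find h = m + 1 := Nat.exists_eq_succ_of_ne_zero fun h0 => by
    have := Nat.find_spec h
    rw [h0] at this
    simp at this
    linarith
  refine ⟨m, not_lt.1 (Nat.find_min h (by omega)), ?_⟩
  have := Nat.find_spec h
  rwa [hm] at this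

theorem intervalIntegrable_and_integral_eq_of_eqOn_Ioo {f : ℝ → ℝ} {a b y : ℝ} (hab : a ≤ b)
    (h : ∀ s ∈ Set.Ioo a b, f s = y) :
    IntervalIntegrable f volume a b ∧ ∫ s in a..b, f s = y * (b - a) := by
  have hae : (fun _ => y) =ᵐ[volume.restrict (Set.uIoc a b)] f := by
    rw [Set.uIoc_of_le hab, ← restrict_Ioo_eq_restrict_Ioc]
    filter_upwards [ae_restrict_mem measurableSet_Ioo] with s hs using (h s hs).symm
  refine ⟨(intervalIntegrable_const (c := y)).congr_ae hae, ?_⟩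
  rw [← intervalIntegral.integral_congr_ae_restrict hae, intervalIntegral.integral_const,
    smul_eq_mul, mul_comm]

/-- The integral of a function of the number of events along a sample path. -/
theorem integral_comp_numEvents (hu : ∀ k, 0 < τ k ω) (g : ℕ → ℝ) {n : ℕ} {t : ℝ}
    (h1 : ∑ i ∈ Finset.range n, τ i ω ≤ t) (h2 : t < ∑ i ∈ Finset.range (n + 1), τ i ω) :
    ∫ s in (0 : ℝ)..t, g (numEvents τ s ω) =
      ∑ k ∈ Finset.range n, g k * τ k ω + g n * (t - ∑ i ∈ Finset.range n, τ i ω) := by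
  have hS := strictMono_sum_range hu
  have hpiece : ∀ k, ∀ b, ∑ i ∈ Finset.range k, τ i ω ≤ b →
      b ≤ ∑ i ∈ Finset.range (k + 1), τ i ω →
      IntervalIntegrable (fun s => g (numEvents τ s ω)) volume
        (∑ i ∈ Finset.range k, τ i ω) b ∧
      ∫ s in (∑ i ∈ Finset.range k, τ i ω)..b, g (numEvents τ s ω) =
        g k * (b - ∑ i ∈ Finset.range k, τ i ω) := fun k b hk hb =>
    intervalIntegrable_and_integral_eq_of_eqOn_Ioo hk fun s hs => by
      rw [numEvents_eq hu hs.1.le (hs.2.trans_le hb)]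
  have hfull := fun k => hpiece k _ (hS.monotone (Nat.le_succ k)) le_rfl
  have hlast := hpiece n t h1 h2.le
  have hinit : IntervalIntegrable (fun s => g (numEvents τ s ω)) volume 0
      (∑ i ∈ Finset.range n, τ i ω) := by
    simpa using IntervalIntegrable.trans_iterate
      (a := fun k => ∑ i ∈ Finset.range k, τ i ω) (n := n) fun k _ => (hfull k).1
  rw [← intervalIntegral.integral_add_adjacent_intervals hinit hlast.1, hlast.2]
  congr 1
  have := intervalIntegral.sum_integral_adjacent_intervals
    (a := fun k => ∑ i ∈ Finset.range k, τ i ω) (n := n) fun k _ => (hfull k).1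
  simp only [Finset.range_zero, Finset.sum_empty] at this
  rw [← this]
  refine Finset.sum_congr rfl fun k _ => ?_
  rw [(hfull k).2, Finset.sum_range_succ, add_sub_cancel_left]

end Path

/-- Induction on `n`, restarting the motion after its first waiting time with remaining time `t - u
0` and frequency `-b`. -/
theorem countedPhase_eq_zero {n : ℕ} {b t : ℝ} {u : ℕ → ℝ} (hu : ∀ k, 0 < u k)
    (h : ¬ (∑ i ∈ Finset.range n, u i ≤ t ∧ t < ∑ i ∈ Finset.range (n + 1), u i)) (ht : 0 ≤ t) :
    countedPhase n b t (fun i => u i) = 0 := by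
  induction n generalizing b t u with
  | zero =>
    -- The lower condition is `0 ≤ t` (empty sum), which holds, so only `t < u 0` can fail.
    rw [countedPhase, if_neg]
    simpa [ht] using h
  | succ n ih =>
    rw [countedPhase]
    split_ifs with h0
    · rw [Finset.sum_range_succ', Finset.sum_range_succ' _ (n + 1)] at h
      have := ih (b := -b) (t := t - u 0) (u := fun k => u (k + 1)) (fun k => hu _)
        (fun h' => h ⟨by linarith [h'.1], by linarith [h'.2]⟩) (sub_nonneg.2 (by simpa using h0))
      simp only [Fin.val_zero, Fin.val_succ]
      rw [this, mul_zero]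
    · rfl

/-- The same restart; the change of sign of the frequency absorbs the shift of index in `(-1) ^ k`.
-/
theorem countedPhase_eq_exp {n : ℕ} {b t : ℝ} {u : ℕ → ℝ} (hu : ∀ k, 0 < u k)
    (h1 : ∑ i ∈ Finset.range n, u i ≤ t) (h2 : t < ∑ i ∈ Finset.range (n + 1), u i) :
    countedPhase n b t (fun i => u i) = Complex.exp (Complex.I * b *
      (∑ k ∈ Finset.range n, (-1) ^ k * u k +
        (-1) ^ n * (t - ∑ i ∈ Finset.range n, u i) : ℝ)) := by
  induction n generalizing b t u with
  | zero =>
    rw [countedPhase, if_pos (by simpa using h2)]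
    simp
  | succ n ih =>
    rw [Finset.sum_range_succ'] at h1
    rw [Finset.sum_range_succ'] at h2
    have h0 : u 0 ≤ t := by
      have := Finset.sum_nonneg fun i (_ : i ∈ Finset.range n) => (hu (i + 1)).le
      linarith
    have := ih (b := -b) (t := t - u 0) (u := fun k => u (k + 1)) (fun k => hu _)
      (by linarith) (by linarith)
    rw [countedPhase, if_pos (by simpa using h0)]
    simp only [Fin.val_zero, Fin.val_succ]
    rw [this, ← Complex.exp_add, Finset.sum_range_succ', Finset.sum_range_succ']
    congr 1
    simp only [pow_succ, mul_neg_one, neg_mul, Finset.sum_neg_distrib]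
    push_cast
    ring

/-! ### Almost sure properties of the waiting times and turns -/

theorem expMeasure_nullSingletonClass (lam : ℝ) : NullSingletonClass (expMeasure lam) :=
  inferInstanceAs (NullSingletonClass (volume.withDensity (exponentialPDF lam)))

/-- With the other terms fixed, the relation forces `τ k` to take one prescribed value, as `a k ≠
0`. By independence and Fubini, the absence of atoms gives probability zero. -/
theorem measure_linearCombination_eq_zero {Ω ι : Type*} [Fintype ι] [MeasurableSpace Ω]
    {P : Measure Ω} [IsProbabilityMeasure P] {τ : ι → Ω → ℝ} (hm : ∀ i, Measurable (τ i))
    (hind : iIndepFun τ P) (hnull : ∀ i x, P.map (τ i) {x} = 0) (a : ι → ℝ) (b : ℝ)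
    {k : ι} (hk : a k ≠ 0) : P {ω | ∑ i, a i * τ i ω = b} = 0 := by
  classical
  have hm' : ∀ i, Measurable fun ω => a i * τ i ω := fun i => (hm i).const_mul _
  have hind' : iIndepFun (fun i ω => a i * τ i ω) P :=
    hind.comp (fun i x => a i * x) fun i => by fun_prop
  have hkZ := (hind'.indepFun_finsetSum_of_notMem hm' (Finset.notMem_erase k Finset.univ)).symm
  have hmZ : Measurable (∑ i ∈ Finset.univ.erase k, fun ω => a i * τ i ω) :=
    by rw [Finset.sum_fn]; exact Finset.measurable_sum _ fun i _ => hm' i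
  have hmap := (indepFun_iff_map_prod_eq_prod_map_map (hm' k).aemeasurable hmZ.aemeasurable).1 hkZ
  have hs : MeasurableSet {x : ℝ × ℝ | x.1 + x.2 = b} :=
    measurableSet_eq_fun (by fun_prop) (by fun_prop)
  have hset : {ω | ∑ i, a i * τ i ω = b} =
      (fun ω => (a k * τ k ω, (∑ i ∈ Finset.univ.erase k, fun ω => a i * τ i ω) ω)) ⁻¹'
        {x : ℝ × ℝ | x.1 + x.2 = b} := by
    ext ω
    simp [Finset.sum_apply]
  have := Measure.isProbabilityMeasure_map (μ := P) (hm' k).aemeasurable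
  have := Measure.isProbabilityMeasure_map (μ := P) hmZ.aemeasurable
  rw [hset, ← Measure.map_apply ((hm' k).prodMk hmZ) hs, hmap, Measure.prod_apply_symm hs]
  refine (lintegral_congr fun z => ?_).trans lintegral_zero
  have hz : (fun x => (x, z)) ⁻¹' {x : ℝ × ℝ | x.1 + x.2 = b} = {b - z} := by
    ext x
    simp [eq_sub_iff_add_eq]
  rw [hz, Measure.map_apply (hm' k) (measurableSet_singleton _)]
  have hw : (fun ω => a k * τ k ω) ⁻¹' {b - z} = τ k ⁻¹' {(b - z) / a k} := by
    ext ω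
    simp [eq_div_iff hk, mul_comm]
  rw [hw, ← Measure.map_apply (hm k) (measurableSet_singleton _), hnull]

theorem expMeasure_Iic {lam x : ℝ} (hlam : 0 < lam) (hx : 0 ≤ x) :
    expMeasure lam (Set.Iic x) = ENNReal.ofReal (1 - Real.exp (-(lam * x))) := by
  have := isProbabilityMeasure_expMeasure hlam
  have h := cdf_expMeasure_eq hlam x
  rw [if_pos hx, cdf_eq_real] at h
  rw [← h, measureReal_def, ENNReal.ofReal_toReal (measure_ne_top _ _)]

namespace IsMotionDriver

variable {Ω : Type*} [MeasurableSpace Ω] {P : Measure Ω}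
  {lam p q : ℝ} {D₀ : Ω → Fin 4} {τ : ℕ → Ω → ℝ} {ξ : ℕ → Ω → Fin 4}

theorem ae_wait_pos (h : IsMotionDriver P lam p q D₀ τ ξ) (hlam : 0 < lam) :
    ∀ᵐ ω ∂P, ∀ k, 0 < τ k ω := by
  refine ae_all_iff.2 fun k => ?_
  have h1 : P (τ k ⁻¹' Set.Iic 0) = 0 := by
    rw [← Measure.map_apply (h.measurable_wait k) measurableSet_Iic, h.wait_law,
      expMeasure_Iic hlam le_rfl]
    simp
  rw [ae_iff]
  simpa [Set.preimage] using h1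

/-- The first `n` waiting times are all at most `t` with probability `(1 - e^{-lam t}) ^ n`, which
tends to zero. This excludes infinitely many events before `t`. -/
theorem ae_exists_wait_gt (h : IsMotionDriver P lam p q D₀ τ ξ) (hlam : 0 < lam)
    {t : ℝ} (ht : 0 ≤ t) : ∀ᵐ ω ∂P, ∃ k, t < τ k ω := by
  have hbound : ∀ n : ℕ, P {ω | ¬ ∃ k, t < τ k ω} ≤
      ENNReal.ofReal (1 - Real.exp (-(lam * t))) ^ n := fun n => by
    calc _ ≤ P (⋂ k ∈ Finset.range n, τ k ⁻¹' Set.Iic t) := by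
          refine measure_mono fun ω hω => ?_
          simp only [Set.mem_ofPred_eq, not_exists, not_lt] at hω
          simp [hω]
      _ = _ := by
          rw [h.indep_wait.measure_inter_preimage_eq_mul _ (fun _ _ => measurableSet_Iic),
            Finset.prod_congr rfl fun k _ => ?_, Finset.prod_const, Finset.card_range]
          rw [← Measure.map_apply (h.measurable_wait k) measurableSet_Iic, h.wait_law,
            expMeasure_Iic hlam ht]
  have hlt : ENNReal.ofReal (1 - Real.exp (-(lam * t))) < 1 := by
    rw [ENNReal.ofReal_lt_one]
    linarith [Real.exp_pos (-(lam * t))]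
  rw [ae_iff]
  exact le_antisymm (ge_of_tendsto' (ENNReal.tendsto_pow_atTop_nhds_zero_of_lt_one hlt) hbound)
    zero_le

/-- The probabilities `p`, `q` and `1 - p - q` of the three nonzero increments already sum to one.
-/
theorem ae_turn_ne_zero [IsProbabilityMeasure P] (h : IsMotionDriver P lam p q D₀ τ ξ) :
    ∀ᵐ ω ∂P, ∀ k, ξ k ω ≠ 0 := by
  refine ae_all_iff.2 fun k => ?_
  have hsum : ∑ j : Fin 4, P.real (ξ k ⁻¹' {j}) = 1 := by
    have := sum_measureReal_preimage_singleton (μ := P) (f := ξ k) Finset.univ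
      (fun j _ => h.measurable_turn k (measurableSet_singleton j))
    simpa using this
  have h1 : P.real (ξ k ⁻¹' {1}) = p := h.turn_counterclockwise k
  have h2 : P.real (ξ k ⁻¹' {2}) = 1 - p - q := h.turn_reflection k
  have h3 : P.real (ξ k ⁻¹' {3}) = q := h.turn_clockwise k
  rw [Fin.sum_univ_four, h1, h2, h3] at hsum
  have h0 : P.real (ξ k ⁻¹' {0}) = 0 := by linarith
  rw [measureReal_eq_zero_iff] at h0
  rw [ae_iff]
  simpa [Set.preimage] using h0

/-- Countably many relations are excluded at once; they will be indexed by the number of events and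
the directions taken. -/
theorem ae_linearCombination_wait_ne [IsProbabilityMeasure P]
    (h : IsMotionDriver P lam p q D₀ τ ξ) {ι : Type*}
    [Countable ι] (n : ι → ℕ) (a : ∀ i, Fin (n i) → ℝ) (b : ι → ℝ) :
    ∀ᵐ ω ∂P, ∀ i, (∃ k, a i k ≠ 0) → ∑ k, a i k * τ k ω ≠ b i := by
  refine ae_all_iff.2 fun i => ?_
  by_cases hk : ∃ k, a i k ≠ 0
  · obtain ⟨k, hk⟩ := hk
    have := measure_linearCombination_eq_zero (P := P) (τ := fun (k : Fin (n i)) => τ k)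
      (fun k => h.measurable_wait k) (h.indep_wait.precomp Fin.val_injective)
      (fun k x => by
        have := expMeasure_nullSingletonClass lam
        rw [h.wait_law, measure_singleton]) (a i) (b i) hk
    rw [ae_iff]
    refine measure_mono_null (fun ω hω => ?_) this
    by_contra hne
    exact hω fun _ => hne
  · exact Filter.Eventually.of_forall fun ω h' => absurd h' hk

end IsMotionDriver

/-! ### Directions, and paths that stay on the horizontal axis -/

theorem orthDir_zero : orthDir 0 = (1, 0) := by simp [orthDir]

theorem orthDir_one : orthDir 1 = (0, 1) := by simp [orthDir]

theorem orthDir_two : orthDir 2 = (-1, 0) := by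
  have : Real.pi / 2 * 2 = Real.pi := by ring
  simp [orthDir, this]

theorem orthDir_three : orthDir 3 = (0, -1) := by
  have : Real.pi / 2 * 3 = Real.pi / 2 + Real.pi := by ring
  simp [orthDir, this, Real.cos_add_pi, Real.sin_add_pi]

theorem orthDir_add_two (j : Fin 4) : orthDir (j + 2) = -orthDir j := by
  fin_cases j
  · simp [orthDir_zero, orthDir_two]
  · change orthDir 3 = -orthDir 1
    simp [orthDir_one, orthDir_three]
  · change orthDir 0 = -orthDir 2
    simp [orthDir_zero, orthDir_two]
  · change orthDir 1 = -orthDir 3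
    simp [orthDir_one, orthDir_three]

theorem orthDir_snd_eq_zero_iff (j : Fin 4) : (orthDir j).2 = 0 ↔ j = 0 ∨ j = 2 := by
  fin_cases j
  · simp [orthDir_zero]
  · simp [orthDir_one]
  · simp [orthDir_two]
  · simp [orthDir_three]

theorem orthDir_add_sum_of_forall_eq_two {j : Fin 4} {x : ℕ → Fin 4} {n : ℕ}
    (hx : ∀ k < n, x k = 2) : orthDir (j + ∑ i ∈ Finset.range n, x i) = (-1 : ℝ) ^ n • orthDir j := by
  induction n with
  | zero => simp
  | succ n ih =>
    rw [Finset.sum_range_succ, hx n n.lt_succ_self, ← add_assoc, orthDir_add_two,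
      ih fun k hk => hx k (hk.trans n.lt_succ_self), pow_succ, mul_neg_one, neg_smul]

section Path

variable {Ω : Type*} {D₀ : Ω → Fin 4} {τ : ℕ → Ω → ℝ} {ξ : ℕ → Ω → Fin 4} {ω : Ω} {c t : ℝ} {n : ℕ}

theorem motionX_eq_of_forall_eq_two (hu : ∀ k, 0 < τ k ω)
    (h1 : ∑ i ∈ Finset.range n, τ i ω ≤ t) (h2 : t < ∑ i ∈ Finset.range (n + 1), τ i ω)
    (hξ : ∀ k < n, ξ k ω = 2) :
    motionX c D₀ τ ξ t ω = c * (orthDir (D₀ ω)).1 * (∑ k ∈ Finset.range n, (-1) ^ k * τ k ω +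
      (-1) ^ n * (t - ∑ i ∈ Finset.range n, τ i ω)) := by
  have := integral_comp_numEvents hu
    (fun m => c * (orthDir (D₀ ω + ∑ k ∈ Finset.range m, ξ k ω)).1) h1 h2
  rw [motionX]
  simp only [dirIndex]
  rw [this, mul_add, Finset.mul_sum, orthDir_add_sum_of_forall_eq_two hξ]
  congr 1
  · refine Finset.sum_congr rfl fun k hk => ?_
    rw [orthDir_add_sum_of_forall_eq_two fun i hi => hξ i (hi.trans (Finset.mem_range.1 hk))]
    simp only [Prod.smul_fst, smul_eq_mul]
    ring
  · simp only [Prod.smul_fst, smul_eq_mul]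
    ring

theorem motionY_eq_zero_of_forall_eq_two (hu : ∀ k, 0 < τ k ω)
    (h1 : ∑ i ∈ Finset.range n, τ i ω ≤ t) (h2 : t < ∑ i ∈ Finset.range (n + 1), τ i ω)
    (hξ : ∀ k < n, ξ k ω = 2) (hD : (orthDir (D₀ ω)).2 = 0) :
    motionY c D₀ τ ξ t ω = 0 := by
  have := integral_comp_numEvents hu
    (fun m => c * (orthDir (D₀ ω + ∑ k ∈ Finset.range m, ξ k ω)).2) h1 h2
  rw [motionY]
  simp only [dirIndex]
  rw [this, orthDir_add_sum_of_forall_eq_two hξ, Finset.sum_eq_zero]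
  · simp [hD]
  · intro k hk
    rw [orthDir_add_sum_of_forall_eq_two fun i hi => hξ i (hi.trans (Finset.mem_range.1 hk))]
    simp [hD]

/-- Up to linear relations between the waiting times, the motion returns to the horizontal axis
only if it has never left it. -/
theorem orthDir_snd_eq_zero_of_motionY_eq_zero (hc : c ≠ 0) (ht : 0 < t) (hu : ∀ k, 0 < τ k ω)
    (h1 : ∑ i ∈ Finset.range n, τ i ω ≤ t) (h2 : t < ∑ i ∈ Finset.range (n + 1), τ i ω)
    (hgen : ∀ (e : Fin n → Fin 4) (j : Fin 4), (∃ k, (orthDir (e k)).2 - (orthDir j).2 ≠ 0) →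
      ∑ k, ((orthDir (e k)).2 - (orthDir j).2) * τ k ω ≠ -((orthDir j).2 * t))
    (hY : motionY c D₀ τ ξ t ω = 0) :
    ∀ k ≤ n, (orthDir (D₀ ω + ∑ i ∈ Finset.range k, ξ i ω)).2 = 0 := by
  have hint := integral_comp_numEvents hu
    (fun m => c * (orthDir (D₀ ω + ∑ k ∈ Finset.range m, ξ k ω)).2) h1 h2
  rw [motionY] at hY
  simp only [dirIndex] at hY
  rw [hint] at hY
  set y : ℕ → ℝ := fun m => (orthDir (D₀ ω + ∑ k ∈ Finset.range m, ξ k ω)).2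
  -- The last segment lasts `t - ∑ τ k`, so collecting the coefficient of each `τ k` gives `y k - y
  -- n`, with constant term `y n * t`.
  have hY' : c * (∑ k ∈ Finset.range n, (y k - y n) * τ k ω + y n * t) = 0 := by
    rw [← hY]
    simp only [sub_mul, Finset.sum_sub_distrib, ← Finset.mul_sum, mul_assoc]
    change _ = c * ∑ k ∈ Finset.range n, y k * τ k ω + c * (y n * _)
    ring
  have hY'' := (mul_eq_zero.1 hY').resolve_left hc
  have heq : ∀ k < n, y k = y n := by
    by_contra! hne
    obtain ⟨k, hk, hne⟩ := hne
    refine hgen (fun k => D₀ ω + ∑ i ∈ Finset.range k, ξ i ω)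
      (D₀ ω + ∑ i ∈ Finset.range n, ξ i ω) ⟨⟨k, hk⟩, sub_ne_zero.2 hne⟩ ?_
    rw [Finset.sum_range] at hY''
    exact eq_neg_of_add_eq_zero_left hY''
  have hn : y n = 0 := by
    rw [Finset.sum_eq_zero fun k hk => by
      rw [heq k (Finset.mem_range.1 hk), sub_self, zero_mul], zero_add] at hY''
    exact (mul_eq_zero.1 hY'').resolve_right ht.ne'
  intro k hk
  rcases hk.lt_or_eq with hk | rfl
  · exact (heq k hk).trans hn
  · exact hn

/-- Two consecutive horizontal directions differ by `0` or `2` modulo `4`, and the increment `0` is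
excluded. -/
theorem eq_two_of_orthDir_snd_eq_zero (hξ0 : ∀ k, ξ k ω ≠ 0)
    (h : ∀ k ≤ n, (orthDir (D₀ ω + ∑ i ∈ Finset.range k, ξ i ω)).2 = 0) :
    ∀ k < n, ξ k ω = 2 := by
  intro k hk
  have h1 := (orthDir_snd_eq_zero_iff _).1 (h k hk.le)
  have h2 := (orthDir_snd_eq_zero_iff _).1 (h (k + 1) hk)
  rw [Finset.sum_range_succ, ← add_assoc] at h2
  have h0 := hξ0 k
  revert h1 h2 h0
  generalize D₀ ω + ∑ i ∈ Finset.range k, ξ i ω = a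
  generalize ξ k ω = b
  revert a b
  decide

/-- The contribution of the paths which start in the direction `j` and have made exactly `n`
turns by time `t`, all of them reflections. -/
noncomputable def reflectionPhase (D₀ : Ω → Fin 4) (τ : ℕ → Ω → ℝ) (ξ : ℕ → Ω → Fin 4)
    (j : Fin 4) (b t : ℝ) (n : ℕ) (ω : Ω) : ℂ :=
  ({j} : Set (Fin 4)).indicator 1 (D₀ ω) *
    ({x : ℕ → Fin 4 | ∀ k < n, x k = 2}.indicator 1 (fun k => ξ k ω) *
      countedPhase n b t (fun i => τ i ω))

theorem norm_reflectionPhase_le (j : Fin 4) (b : ℝ) :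
    ‖reflectionPhase D₀ τ ξ j b t n ω‖ ≤ 1 := by
  classical
  have h : ∀ {X : Type} (s : Set X) x, ‖s.indicator (1 : X → ℂ) x‖ ≤ 1 := fun s x => by
    by_cases hx : x ∈ s <;> simp [hx]
  rw [reflectionPhase, norm_mul, norm_mul]
  exact mul_le_one₀ (h _ _) (by positivity)
    (mul_le_one₀ (h _ _) (norm_nonneg _) (norm_countedPhase_le _ _ _ _))

theorem reflectionPhase_eq_zero (hu : ∀ k, 0 < τ k ω) (ht : 0 ≤ t)
    (h1 : ∑ i ∈ Finset.range n, τ i ω ≤ t) (h2 : t < ∑ i ∈ Finset.range (n + 1), τ i ω)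
    (j : Fin 4) (b : ℝ) {m : ℕ} (hm : m ≠ n) : reflectionPhase D₀ τ ξ j b t m ω = 0 := by
  rw [reflectionPhase, countedPhase_eq_zero (u := fun k => τ k ω) hu ?_ ht, mul_zero, mul_zero]
  rintro ⟨h3, h4⟩
  exact hm ((numEvents_eq hu h3 h4).symm.trans (numEvents_eq hu h1 h2))

/-- On a path confined to the axis, starting along `d_2` instead of `d_0` negates `X(t)`, hence the
two frequencies `α c` and `-(α c)`. On any other generic path both sides vanish. -/
theorem indicator_eq_reflectionPhase_add (hc : c ≠ 0) (ht : 0 < t) (hu : ∀ k, 0 < τ k ω)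
    (h1 : ∑ i ∈ Finset.range n, τ i ω ≤ t) (h2 : t < ∑ i ∈ Finset.range (n + 1), τ i ω)
    (hgen : ∀ (e : Fin n → Fin 4) (j : Fin 4), (∃ k, (orthDir (e k)).2 - (orthDir j).2 ≠ 0) →
      ∑ k, ((orthDir (e k)).2 - (orthDir j).2) * τ k ω ≠ -((orthDir j).2 * t))
    (hξ0 : ∀ k, ξ k ω ≠ 0) (α : ℝ) :
    {ω | motionY c D₀ τ ξ t ω = 0}.indicator
        (fun ω => Complex.exp (Complex.I * α * motionX c D₀ τ ξ t ω)) ω =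
      reflectionPhase D₀ τ ξ 0 (α * c) t n ω + reflectionPhase D₀ τ ξ 2 (-(α * c)) t n ω := by
  classical
  by_cases hall : (∀ k < n, ξ k ω = 2) ∧ (orthDir (D₀ ω)).2 = 0
  · obtain ⟨hξ, hD⟩ := hall
    rw [Set.indicator_of_mem
      (show ω ∈ {ω | motionY c D₀ τ ξ t ω = 0} from
        motionY_eq_zero_of_forall_eq_two hu h1 h2 hξ hD),
      motionX_eq_of_forall_eq_two hu h1 h2 hξ, reflectionPhase, reflectionPhase,
      countedPhase_eq_exp (u := fun k => τ k ω) hu h1 h2,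
      countedPhase_eq_exp (u := fun k => τ k ω) hu h1 h2,
      Set.indicator_of_mem (show (fun k => ξ k ω) ∈ {x : ℕ → Fin 4 | ∀ k < n, x k = 2} from hξ)]
    rcases (orthDir_snd_eq_zero_iff _).1 hD with h0 | h0
    · rw [h0, orthDir_zero]
      simp [mul_assoc]
    · rw [h0, orthDir_two]
      simp [mul_assoc]
  · rw [Set.indicator_of_notMem, reflectionPhase, reflectionPhase]
    · by_cases hξ : ∀ k < n, ξ k ω = 2
      · have hD : ¬ (D₀ ω = 0 ∨ D₀ ω = 2) := fun h =>
          hall ⟨hξ, (orthDir_snd_eq_zero_iff _).2 h⟩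
        push Not at hD
        simp [hD.1, hD.2]
      · rw [Set.indicator_of_notMem
          (show (fun k => ξ k ω) ∉ {x : ℕ → Fin 4 | ∀ k < n, x k = 2} from hξ)]
        simp
    · intro hY
      have h := orthDir_snd_eq_zero_of_motionY_eq_zero hc ht hu h1 h2 hgen hY
      exact hall ⟨eq_two_of_orthDir_snd_eq_zero hξ0 h, by simpa using h 0 n.zero_le⟩

end Path

/-! ### Expectations and summation over the number of reflections -/

theorem measurableSet_forall_lt_eq (n : ℕ) (j : Fin 4) :
    MeasurableSet {x : ℕ → Fin 4 | ∀ k < n, x k = j} := by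
  have : {x : ℕ → Fin 4 | ∀ k < n, x k = j} = ⋂ k, ⋂ _ : k < n, (fun x => x k) ⁻¹' {j} := by
    ext x; simp
  rw [this]
  exact MeasurableSet.iInter fun k => MeasurableSet.iInter fun _ =>
    (measurable_pi_apply k) (measurableSet_singleton j)

theorem measurable_turnPhase (n : ℕ) (b t : ℝ) :
    Measurable fun x : (ℕ → ℝ) × (ℕ → Fin 4) =>
      {x : ℕ → Fin 4 | ∀ k < n, x k = 2}.indicator (1 : (ℕ → Fin 4) → ℂ) x.2 *
        countedPhase n b t (fun i => x.1 i) := by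
  refine Measurable.mul ?_ ?_
  · exact (measurable_one.indicator (measurableSet_forall_lt_eq n 2)).comp measurable_snd
  · exact (measurable_countedPhase n b).comp
      (f := fun x : (ℕ → ℝ) × (ℕ → Fin 4) => (t, fun i : Fin (n + 1) => x.1 i)) (by fun_prop)

namespace IsMotionDriver

variable {Ω : Type*} [MeasurableSpace Ω] {P : Measure Ω}
  {lam p q : ℝ} {D₀ : Ω → Fin 4} {τ : ℕ → Ω → ℝ} {ξ : ℕ → Ω → Fin 4}

theorem measurable_reflectionPhase (h : IsMotionDriver P lam p q D₀ τ ξ) (j : Fin 4) (b t : ℝ)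
    (n : ℕ) : Measurable (reflectionPhase D₀ τ ξ j b t n) := by
  have h1 := h.measurable_wait
  have h2 := h.measurable_turn
  refine Measurable.mul ?_ ?_
  · exact (measurable_one.indicator (measurableSet_singleton j)).comp h.measurable_init
  · exact (measurable_turnPhase n b t).comp
      (f := fun ω => ((fun k => τ k ω), (fun k => ξ k ω))) (by fun_prop)

/-- Independence splits the expectation into `1 / 4` for the start, `(1 - p - q) ^ n` for the turns
and the mean phase of the waiting times. -/
theorem integral_reflectionPhase [IsProbabilityMeasure P]
    (h : IsMotionDriver P lam p q D₀ τ ξ) (hlam : 0 < lam)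
    (j : Fin 4) (b : ℝ) {t : ℝ} (ht : 0 ≤ t) (n : ℕ) :
    ∫ ω, reflectionPhase D₀ τ ξ j b t n ω ∂P =
      Complex.exp (-(lam * t)) / 4 *
        (((lam * (1 - p - q) : ℝ) : ℂ) ^ n * alternatingVolterra n b t) := by
  have h1 := h.measurable_wait
  have h2 := h.measurable_turn
  have hτ : Measurable fun ω k => τ k ω := by fun_prop
  have hξ : Measurable fun ω k => ξ k ω := by fun_prop
  have hinit : ∫ ω, ({j} : Set (Fin 4)).indicator (1 : Fin 4 → ℂ) (D₀ ω) ∂P = 1 / 4 := by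
    have hj : P.real (D₀ ⁻¹' {j}) = 1 / 4 := h.init_law j
    change ∫ ω, (D₀ ⁻¹' {j}).indicator (fun _ => (1 : ℂ)) ω ∂P = _
    rw [integral_indicator_const _ (h.measurable_init (measurableSet_singleton j)), hj]
    simp
  have hturn : ∫ ω, {x : ℕ → Fin 4 | ∀ k < n, x k = 2}.indicator (1 : (ℕ → Fin 4) → ℂ)
      (fun k => ξ k ω) ∂P = ((1 - p - q : ℝ) : ℂ) ^ n := by
    have hmeas := hξ (measurableSet_forall_lt_eq n 2)
    change ∫ ω, ((fun ω k => ξ k ω) ⁻¹' {x : ℕ → Fin 4 | ∀ k < n, x k = 2}).indicator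
      (fun _ => (1 : ℂ)) ω ∂P = _
    rw [integral_indicator_const _ hmeas]
    have hset : (fun ω k => ξ k ω) ⁻¹' {x : ℕ → Fin 4 | ∀ k < n, x k = 2} =
        ⋂ k ∈ Finset.range n, ξ k ⁻¹' {2} := by
      ext ω; simp
    have hreal : P.real ((fun ω k => ξ k ω) ⁻¹' {x : ℕ → Fin 4 | ∀ k < n, x k = 2}) =
        (1 - p - q) ^ n := by
      rw [hset, measureReal_def, h.indep_turn.measure_inter_preimage_eq_mul _
        (fun _ _ => measurableSet_singleton _), ENNReal.toReal_prod]
      rw [Finset.prod_congr rfl fun k _ =>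
        show (P (ξ k ⁻¹' {2})).toReal = 1 - p - q from h.turn_reflection k, Finset.prod_const,
        Finset.card_range]
    rw [hreal, Complex.real_smul, mul_one]
    push_cast
    rfl
  have hwait : ∫ ω, countedPhase n b t (fun i => τ i ω) ∂P =
      Complex.exp (-(lam * t)) * (lam : ℂ) ^ n * alternatingVolterra n b t := by
    have hmap := (iIndepFun_iff_map_fun_eq_pi_map (μ := P) (f := fun (i : Fin (n + 1)) => τ i)
      fun i => (h1 i).aemeasurable).1 (h.indep_wait.precomp Fin.val_injective)
    simp only [h.wait_law] at hmap
    rw [← integral_countedPhase hlam n b ht, ← hmap, integral_map]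
    · exact Measurable.aemeasurable (by fun_prop)
    · exact Measurable.aestronglyMeasurable ((measurable_countedPhase n b).comp
        (f := fun u : Fin (n + 1) → ℝ => (t, u)) (by fun_prop))
  simp only [reflectionPhase]
  rw [h.indep_init.integral_fun_comp_mul_comp
      (g := fun x : (ℕ → ℝ) × (ℕ → Fin 4) =>
        {x : ℕ → Fin 4 | ∀ k < n, x k = 2}.indicator (1 : (ℕ → Fin 4) → ℂ) x.2 *
        countedPhase n b t (fun i => x.1 i)) h.measurable_init.aemeasurable
      (Measurable.aemeasurable (by fun_prop))
      (Measurable.aestronglyMeasurable (measurable_one.indicator (measurableSet_singleton j)))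
      (measurable_turnPhase n b t).aestronglyMeasurable, hinit]
  dsimp only
  rw [h.indep_wait_turn.symm.integral_fun_comp_mul_comp
      (g := fun x : ℕ → ℝ => countedPhase n b t (fun i => x i)) hξ.aemeasurable hτ.aemeasurable
      (measurable_one.indicator (measurableSet_forall_lt_eq n 2)).aestronglyMeasurable
      (Measurable.aestronglyMeasurable ((measurable_countedPhase n b).comp
        (f := fun u : ℕ → ℝ => (t, fun i : Fin (n + 1) => u i)) (by fun_prop))), hturn, hwait, Complex.ofReal_mul,
    mul_pow]
  ring

theorem tendsto_sum_integral [IsProbabilityMeasure P]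
    (h : IsMotionDriver P lam p q D₀ τ ξ) (hlam : 0 < lam) {c t : ℝ}
    (hc : c ≠ 0) (ht : 0 < t) (α : ℝ) :
    Filter.Tendsto (fun M => ∑ n ∈ Finset.range M,
      (∫ ω, reflectionPhase D₀ τ ξ 0 (α * c) t n ω ∂P +
        ∫ ω, reflectionPhase D₀ τ ξ 2 (-(α * c)) t n ω ∂P)) Filter.atTop
      (nhds (∫ ω, {ω | motionY c D₀ τ ξ t ω = 0}.indicator
          (fun ω => Complex.exp (Complex.I * α * motionX c D₀ τ ξ t ω)) ω ∂P)) := by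
  have hint : ∀ j b n, Integrable (reflectionPhase D₀ τ ξ j b t n) P := fun j b n =>
    Integrable.of_bound (h.measurable_reflectionPhase j b t n).aestronglyMeasurable 1
      (Filter.Eventually.of_forall fun ω => norm_reflectionPhase_le j b)
  have hsum : ∀ M, ∑ n ∈ Finset.range M,
      (∫ ω, reflectionPhase D₀ τ ξ 0 (α * c) t n ω ∂P +
        ∫ ω, reflectionPhase D₀ τ ξ 2 (-(α * c)) t n ω ∂P) =
      ∫ ω, ∑ n ∈ Finset.range M, (reflectionPhase D₀ τ ξ 0 (α * c) t n ω +
        reflectionPhase D₀ τ ξ 2 (-(α * c)) t n ω) ∂P := fun M => by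
    refine Eq.trans (Finset.sum_congr rfl fun n _ => (integral_add (hint _ _ n) (hint _ _ n)).symm)
      (integral_finsetSum _ fun n _ => ?_).symm
    exact (hint _ _ n).add (hint _ _ n)
  simp_rw [hsum]
  -- Only the term whose index is the actual number of events survives, so the partial sums jump
  -- once from `0` to the integrand. They are thus bounded by `1` and eventually constant.
  have hgood : ∀ᵐ ω ∂P, ∃ n, ∀ M,
      ∑ m ∈ Finset.range M, (reflectionPhase D₀ τ ξ 0 (α * c) t m ω +
        reflectionPhase D₀ τ ξ 2 (-(α * c)) t m ω) =
      if n < M then {ω | motionY c D₀ τ ξ t ω = 0}.indicator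
          (fun ω => Complex.exp (Complex.I * α * motionX c D₀ τ ξ t ω)) ω else 0 := by
    filter_upwards [h.ae_wait_pos hlam, h.ae_exists_wait_gt hlam ht.le, h.ae_turn_ne_zero,
      h.ae_linearCombination_wait_ne (ι := (n : ℕ) × (Fin n → Fin 4) × Fin 4) (fun i => i.1)
        (fun i k => (orthDir (i.2.1 k)).2 - (orthDir i.2.2).2) (fun i => -((orthDir i.2.2).2 * t))]
      with ω hu hex hξ0 hgen
    obtain ⟨k, hk⟩ := hex
    obtain ⟨n, h1, h2⟩ := exists_sum_range_le_lt (u := fun k => τ k ω) ht.le ⟨k + 1, by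
      rw [Finset.sum_range_succ]
      exact lt_add_of_nonneg_of_lt (Finset.sum_nonneg fun i _ => (hu i).le) hk⟩
    refine ⟨n, fun M => ?_⟩
    rw [indicator_eq_reflectionPhase_add hc ht hu h1 h2 (fun e j => hgen ⟨n, e, j⟩) hξ0 α]
    have hzero : ∀ m, m ≠ n → reflectionPhase D₀ τ ξ 0 (α * c) t m ω +
        reflectionPhase D₀ τ ξ 2 (-(α * c)) t m ω = 0 := fun m hm => by
      rw [reflectionPhase_eq_zero hu ht.le h1 h2 _ _ hm,
        reflectionPhase_eq_zero hu ht.le h1 h2 _ _ hm, add_zero]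
    split_ifs with hM
    · exact Finset.sum_eq_single_of_mem n (Finset.mem_range.2 hM) fun m _ hm => hzero m hm
    · exact Finset.sum_eq_zero fun m hm => hzero m fun hmn =>
        hM (hmn ▸ Finset.mem_range.1 hm)
  refine tendsto_integral_of_dominated_convergence (fun _ => (1 : ℝ)) (fun M => ?_)
    (integrable_const _) (fun M => ?_) ?_
  · exact (Finset.measurable_sum _ fun n _ => (h.measurable_reflectionPhase _ _ _ n).add
      (h.measurable_reflectionPhase _ _ _ n)).aestronglyMeasurable
  · filter_upwards [hgood] with ω ⟨n, hn⟩
    rw [hn M]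
    split_ifs
    · refine (norm_indicator_le_norm_self _ _).trans ?_
      rw [norm_exp_I_mul_mul]
    · simp
  · filter_upwards [hgood] with ω ⟨n, hn⟩
    refine tendsto_const_nhds.congr' ?_
    filter_upwards [Filter.eventually_gt_atTop n] with M hM
    rw [hn M, if_pos hM]

theorem integral_eq_of_tendsto [IsProbabilityMeasure P]
    (h : IsMotionDriver P lam p q D₀ τ ξ) (hlam : 0 < lam) {c t : ℝ}
    (hc : c ≠ 0) (ht : 0 < t) (α : ℝ) {x y : ℂ}
    (hx : Filter.Tendsto (fun N => ∑ n ∈ Finset.range N,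
      ((lam * (1 - p - q) : ℝ) : ℂ) ^ n * alternatingVolterra n (α * c) t) Filter.atTop (nhds x))
    (hy : Filter.Tendsto (fun N => ∑ n ∈ Finset.range N,
      ((lam * (1 - p - q) : ℝ) : ℂ) ^ n * alternatingVolterra n (-(α * c)) t)
      Filter.atTop (nhds y)) :
    ∫ ω, {ω | motionY c D₀ τ ξ t ω = 0}.indicator
          (fun ω => Complex.exp (Complex.I * α * motionX c D₀ τ ξ t ω)) ω ∂P =
      Complex.exp (-(lam * t)) / 4 * (x + y) := by
  refine tendsto_nhds_unique (h.tendsto_sum_integral hlam hc ht α)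
    (((hx.add hy).const_mul (Complex.exp (-(lam * t)) / 4)).congr fun M => ?_)
  rw [← Finset.sum_add_distrib, Finset.mul_sum]
  refine Finset.sum_congr rfl fun n _ => ?_
  rw [h.integral_reflectionPhase hlam _ _ ht.le, h.integral_reflectionPhase hlam _ _ ht.le, mul_add]

end IsMotionDriver

/-! ### The closed formula -/

theorem mainTheorem7 {Ω : Type*} [MeasurableSpace Ω] (P : Measure Ω) [IsProbabilityMeasure P]
    (lam c p q : ℝ) (hlam : 0 < lam) (hc : 0 < c) (hp : 0 ≤ p) (hq : 0 ≤ q) (hpq : p + q ≤ 1)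
    (D₀ : Ω → Fin 4) (τ : ℕ → Ω → ℝ) (ξ : ℕ → Ω → Fin 4)
    (hdrive : IsMotionDriver P lam p q D₀ τ ξ)
    (t : ℝ) (ht : 0 < t) (α : ℝ) :
    (∀ s : ℂ, s ^ 2 = ((lam ^ 2 * (1 - p - q) ^ 2 - α ^ 2 * c ^ 2 : ℝ) : ℂ) → s ≠ 0 →
      ∫ ω, {ω | motionY c D₀ τ ξ t ω = 0}.indicator
          (fun ω => Complex.exp (Complex.I * α * motionX c D₀ τ ξ t ω)) ω ∂P
        = Complex.exp (-(lam * t)) / 4 *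
          ((1 + lam * (1 - p - q) / s) * Complex.exp (t * s)
            + (1 - lam * (1 - p - q) / s) * Complex.exp (-(t * s)))) ∧
    (lam ^ 2 * (1 - p - q) ^ 2 - α ^ 2 * c ^ 2 = 0 →
      ∫ ω, {ω | motionY c D₀ τ ξ t ω = 0}.indicator
          (fun ω => Complex.exp (Complex.I * α * motionX c D₀ τ ξ t ω)) ω ∂P
        = Complex.exp (-(lam * t)) / 2 * (1 + lam * (1 - p - q) * t)) := by
  have hcast : ((lam * (1 - p - q) : ℝ) : ℂ) = lam * (1 - p - q) := by push_cast; rfl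
  refine ⟨fun s hs hs0 => ?_, fun h0 => ?_⟩
  -- The equation for `s` involves `b` only through `b ^ 2`, so one root serves both frequencies;
  -- the terms `± I α c / s` then cancel in the sum.
  · have hs' : ∀ b, b ^ 2 = (α * c) ^ 2 →
        s ^ 2 = (((lam * (1 - p - q)) ^ 2 - b ^ 2 : ℝ) : ℂ) := fun b hb => by
      rw [hs, hb, mul_pow, mul_pow]
    rw [hdrive.integral_eq_of_tendsto hlam hc.ne' ht α
      (tendsto_sum_alternatingVolterra_of_ne_zero (hs' _ rfl) hs0 ht.le)
      (tendsto_sum_alternatingVolterra_of_ne_zero (hs' _ (neg_sq _)) hs0 ht.le), hcast]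
    push_cast
    ring
  · have h0' : ∀ b, b ^ 2 = (α * c) ^ 2 → (lam * (1 - p - q)) ^ 2 - b ^ 2 = 0 := fun b hb => by
      rw [hb, mul_pow, mul_pow, h0]
    rw [hdrive.integral_eq_of_tendsto hlam hc.ne' ht α
      (tendsto_sum_alternatingVolterra_of_eq_zero (h0' _ rfl) ht.le)
      (tendsto_sum_alternatingVolterra_of_eq_zero (h0' _ (neg_sq _)) ht.le), hcast]
    push_cast
    ring
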